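/- **Theorem.** Let $\Omega\subset\mathbb{C}^2$ be a bounded pseudoconvex domain with smooth boundary, with coordinates $(z,w)$ on $\mathbb C^2$. A *defining function* of $\Omega$ is a $C^\infty$ function $\rho:\mathbb{C}^2\to\mathbb{R}$ with $\Omega=\{\rho<0\}$, $\mathbb{C}^2\setminus\overline\Omega=\{\rho>0\}$ and $d\rho\neq0$ on $\partial\Omega$; smooth boundary means that such a $\rho$ exists. Fix one and, on $\partial\Omega$, put $$L=\frac{1}{\sqrt{|\rho_z|^2+|\rho_w|^2}}\Big(\rho_w\,\frac{\partial}{\partial z}-\rho_z\,\frac{\partial}{\partial w}\Big),$$ the normalized holomorphic tangential vector field. For $V=v_1\partial/\partial z_1+v_2\partial/\partial z_2$, with $(z_1,z_2)=(z,w)$, write $\mathrm{Hess}_f(V,V)=\sum_{j,k}\frac{\partial^2 f}{\partial z_j\partial\bar z_k}v_j\bar v_k$. Pseudoconvexity means that the Levi form satisfies $\mathrm{Hess}_\rho(L,L)\ge0$ on $\partial\Omega$. Let $\Sigma=\{p\in\partial\Omega:\mathrm{Hess}_\rho(L,L)(p)=0\}$ be the set of Levi-flat points; neither notion depends on the choice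 of $\rho$. Assume that $\Sigma$ is a smooth simple compact real curve transversal to the holomorphic tangent vector field, that is, $\Sigma=\gamma([0,r])$ for some $r>0$ and some $C^\infty$ map $\gamma:\mathbb{R}\to\mathbb{C}^2$ which either is injective on $[0,r]$ (an arc) or is $r$-periodic and injective on $[0,r)$ (a closed curve), such that for every $t\in[0,r]$ the real vectors $\gamma'(t)$, $\mathrm{Re}\,L(\gamma(t))$ and $\mathrm{Im}\,L(\gamma(t))$ are linearly independent over $\mathbb{R}$. Then the Diederich–Fornæss index of $\Omega$ is $1$: the supremum of all $\tau\in(0,1)$ for which there is a defining function $\tilde\rho$ of $\Omega$ such that $-(-\tilde\rho)^{\tau}$ is plurisubharmonic on $\Omega$ equals $1$. -/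

import Mathlib

open scoped ContDiff

noncomputable section

namespace DFIndex

/-- The Wirtinger derivative `∂f/∂z = (∂f/∂x - i ∂f/∂y) / 2` at `p`, where `ℂ²` has the coordinates
`(z, w)` and `z = x + i y`. -/
def wirtingerZ (f : ℂ × ℂ → ℝ) (p : ℂ × ℂ) : ℂ :=
  (1 / 2 : ℂ) *
    ((fderiv ℝ f p (1, 0) : ℂ) - Complex.I * (fderiv ℝ f p (Complex.I, 0) : ℂ))

/-- The Wirtinger derivative `∂f/∂w = (∂f/∂u - i ∂f/∂v) / 2` at `p`, where `w = u + i v`. -/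
def wirtingerW (f : ℂ × ℂ → ℝ) (p : ℂ × ℂ) : ℂ :=
  (1 / 2 : ℂ) *
    ((fderiv ℝ f p (0, 1) : ℂ) - Complex.I * (fderiv ℝ f p (0, Complex.I) : ℂ))

/-- The complex Hessian of `f` at `p` on the holomorphic vector
`V = v₁ ∂/∂z + v₂ ∂/∂w = (X - i JX) / 2`, where `X` is the real vector `v` and `JX` is `i v`:
`Hess_f(V, V) = V (V̄ f) = (X X f + JX JX f) / 4 = ∑ j k, ∂²f/∂z_j∂z̄_k * v_j * conj v_k`. -/
def complexHessian (f : ℂ × ℂ → ℝ) (p v : ℂ × ℂ) : ℝ :=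
  (1 / 4 : ℝ) *
    (fderiv ℝ (fderiv ℝ f) p v v +
      fderiv ℝ (fderiv ℝ f) p (Complex.I • v) (Complex.I • v))

/-- A twice continuously differentiable function on the open set `Ω` is plurisubharmonic when its
complex Hessian is positive semidefinite at every point of `Ω`. -/
def PlurisubharmonicOn (Ω : Set (ℂ × ℂ)) (f : ℂ × ℂ → ℝ) : Prop :=
  ContDiffOn ℝ 2 f Ω ∧ ∀ p ∈ Ω, ∀ v : ℂ × ℂ, 0 ≤ complexHessian f p v

/-- `ρ` is a (smooth) defining function of `Ω`. -/
structure IsDefiningFunction (Ω : Set (ℂ × ℂ)) (ρ : ℂ × ℂ → ℝ) : Prop where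
  smooth : ContDiff ℝ ∞ ρ
  neg_iff : ∀ p, ρ p < 0 ↔ p ∈ Ω
  pos_iff : ∀ p, 0 < ρ p ↔ p ∉ closure Ω
  fderiv_ne_zero : ∀ p ∈ frontier Ω, fderiv ℝ ρ p ≠ 0

/-- The coefficients with respect to `∂/∂z, ∂/∂w` of the normalized holomorphic tangential vector
field `L = (ρ_w ∂/∂z - ρ_z ∂/∂w) / √(|ρ_z|² + |ρ_w|²)`. -/
def tangentL (ρ : ℂ × ℂ → ℝ) (p : ℂ × ℂ) : ℂ × ℂ :=
  ((√(‖wirtingerZ ρ p‖ ^ 2 + ‖wirtingerW ρ p‖ ^ 2))⁻¹ : ℝ) •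
    (wirtingerW ρ p, -wirtingerZ ρ p)

/-- The real vector `Re V = (V + V̄) / 2` of a holomorphic vector `V = f ∂/∂z + g ∂/∂w`. Since
`V + V̄ = Re f ∂/∂x + Im f ∂/∂y + Re g ∂/∂u + Im g ∂/∂v`, it is `(f, g) / 2` in `ℂ² = ℝ⁴`. -/
def realPart (V : ℂ × ℂ) : ℂ × ℂ := (1 / 2 : ℝ) • V

/-- The real vector `Im V = (V - V̄) / (2 i)` of a holomorphic vector `V = f ∂/∂z + g ∂/∂w`. Since
`2 Im V = Im f ∂/∂x - Re f ∂/∂y + Im g ∂/∂u - Re g ∂/∂v`, it is `-i (f, g) / 2` in `ℂ² = ℝ⁴`. -/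
def imagPart (V : ℂ × ℂ) : ℂ × ℂ := (1 / 2 : ℝ) • (-Complex.I • V)

/-- Pseudoconvexity of a domain with smooth boundary and defining function `ρ`: the Levi form is
nonnegative on the boundary. In `ℂ²` the holomorphic tangent space of the boundary is spanned by
`L`. The condition does not depend on the choice of `ρ`. -/
def IsPseudoconvex (Ω : Set (ℂ × ℂ)) (ρ : ℂ × ℂ → ℝ) : Prop :=
  ∀ p ∈ frontier Ω, 0 ≤ complexHessian ρ p (tangentL ρ p)

/-- The set of Levi-flat points: the boundary points at which the Levi form vanishes. It does not
depend on the choice of the defining function `ρ`. -/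
def leviFlatSet (Ω : Set (ℂ × ℂ)) (ρ : ℂ × ℂ → ℝ) : Set (ℂ × ℂ) :=
  {p | p ∈ frontier Ω ∧ complexHessian ρ p (tangentL ρ p) = 0}

/-- `γ`, on the parameter interval `[0, r]`, is a smooth parametrization of a simple compact curve,
which is either an arc (with two distinct endpoints) or a smooth closed curve. -/
structure IsSimpleSmoothCurve (γ : ℝ → ℂ × ℂ) (r : ℝ) : Prop where
  length_pos : 0 < r
  smooth : ContDiff ℝ ∞ γ
  simple : Set.InjOn γ (Set.Icc 0 r) ∨ (Function.Periodic γ r ∧ Set.InjOn γ (Set.Ico 0 r))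

/-- The curve `γ` is transversal at the parameter `t` to the holomorphic vector `V`: the real
vectors `γ'(t)`, `Re V` and `Im V` are linearly independent. -/
def TransversalAt (γ : ℝ → ℂ × ℂ) (t : ℝ) (V : ℂ × ℂ) : Prop :=
  LinearIndependent ℝ ![deriv γ t, realPart V, imagPart V]

/-- `τ` is a Diederich–Fornæss exponent of `Ω`. -/
def IsDFExponent (Ω : Set (ℂ × ℂ)) (τ : ℝ) : Prop :=
  0 < τ ∧ τ < 1 ∧
    ∃ ρ : ℂ × ℂ → ℝ, IsDefiningFunction Ω ρ ∧ PlurisubharmonicOn Ω (fun p => -((-ρ p) ^ τ))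

/-- The Diederich–Fornæss index of `Ω`: the supremum of its Diederich–Fornæss exponents. -/
def dfIndex (Ω : Set (ℂ × ℂ)) : ℝ := sSup {τ : ℝ | IsDFExponent Ω τ}

end DFIndex

end

open scoped ContDiff

noncomputable section

namespace DFIndex

/-! ### Second derivatives of compositions, products and sums. -/

section Calculus

variable {V : Type*} [NormedAddCommGroup V] [NormedSpace ℝ V]

/-! Every `τ` in `(0, 1)` is shown to be an exponent, with a defining function that equals `ρ e ^ ψ`
near the boundary. Up to a positive factor, the Hessian of `-(-ρ e ^ ψ) ^ τ` is `collarForm`. In the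
frame formed by the complex tangent `T` and the complex normal `N`, its `NN` entry tends to `(1 - τ)
* normalSq ρ > 0` at the boundary. Its `TN` entries have a factor `-ρ`, and its `TT` entry is `-ρ
(levi ρ - ρ A)`, where `A` is `tangentCoeff`, essentially minus the Hessian of `ψ` on `T`. By
`herm_nonneg`, positivity reduces to a determinant inequality; after division by `-ρ` its left side
is still `O(ρ)`.

Where the Levi form is positive, the inequality therefore holds near the boundary. Near a Levi-flat
point, `levi ρ ≥ D ρ` inside `Ω` because `levi ρ ≥ 0` on the boundary
(`eventually_mul_le_of_nonneg`), so it suffices that `A - D` exceed the squared mixed term divided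
by the `NN` entry.

Transversality provides a function `f` with `df = 0` on the flat curve and positive Hessian on `T`
there: a finite sum of squares of functions vanishing on the curve (`exists_psh_in_direction`). Take
`ψ = -C f`. On the curve `dψ = 0`, so the mixed term does not depend on `C` while `A` grows linearly
in `C`; compactness of the curve gives one `C` that works everywhere (`exists_weight`).

Away from the boundary nothing is known, so `-(-ρ e ^ ψ) ^ τ` is composed with a convex
nondecreasing function that is constant on very negative values. This composition is again of the
form `-(-g) ^ τ` with `g` smooth and equal to `ρ e ^ ψ` near the boundary (`exists_truncation_rpow`,
`isDFExponent_of_collarForm_nonneg`). -/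

theorem fderiv_fderiv_comp {f : V → ℝ} {G : ℝ → ℝ} {p : V} (hG : ContDiffAt ℝ 2 G (f p))
    (hf : ContDiffAt ℝ 2 f p) (u : V) :
    fderiv ℝ (fderiv ℝ (fun x => G (f x))) p u u =
      deriv (deriv G) (f p) * (fderiv ℝ f p u) ^ 2 +
        deriv G (f p) * fderiv ℝ (fderiv ℝ f) p u u := by
  have hG1 : ContDiffAt ℝ 1 (fderiv ℝ G) (f p) := hG.fderiv_right (by norm_num)
  have hf1 : ContDiffAt ℝ 1 (fderiv ℝ f) p := hf.fderiv_right (by norm_num)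
  have hdG : DifferentiableAt ℝ (deriv G) (f p) :=
    (hG1.clm_apply contDiffAt_const).differentiableAt (by norm_num)
  have hdf : DifferentiableAt ℝ (fderiv ℝ f) p := hf1.differentiableAt (by norm_num)
  have hfp : DifferentiableAt ℝ f p := hf.differentiableAt (by norm_num)
  have hev : fderiv ℝ (fun x => G (f x)) =ᶠ[nhds p] fun x => deriv G (f x) • fderiv ℝ f x := by
    have h1 : ∀ᶠ x in nhds p, ContDiffAt ℝ 2 f x := hf.eventually (by simp)
    have h2 : ∀ᶠ x in nhds p, ContDiffAt ℝ 2 G (f x) :=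
      hfp.continuousAt.eventually (hG.eventually (by simp))
    filter_upwards [h1, h2] with x hx1 hx2
    have := (hx2.differentiableAt (by norm_num)).hasDerivAt.comp_hasFDerivAt x
      (hx1.differentiableAt (by norm_num)).hasFDerivAt
    exact this.fderiv
  rw [hev.fderiv_eq]
  have h3 : HasFDerivAt (fun x => deriv G (f x)) (deriv (deriv G) (f p) • fderiv ℝ f p) p :=
    hdG.hasDerivAt.comp_hasFDerivAt p hfp.hasFDerivAt
  rw [(h3.fun_smul hdf.hasFDerivAt).fderiv]
  simp
  ring

theorem fderiv_fderiv_mul {f g : V → ℝ} {p : V} (hf : ContDiffAt ℝ 2 f p)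
    (hg : ContDiffAt ℝ 2 g p) (u : V) :
    fderiv ℝ (fderiv ℝ (fun x => f x * g x)) p u u =
      f p * fderiv ℝ (fderiv ℝ g) p u u + 2 * fderiv ℝ f p u * fderiv ℝ g p u +
        g p * fderiv ℝ (fderiv ℝ f) p u u := by
  have hf1 : DifferentiableAt ℝ (fderiv ℝ f) p :=
    (hf.fderiv_right (m := 1) (by norm_num)).differentiableAt (by norm_num)
  have hg1 : DifferentiableAt ℝ (fderiv ℝ g) p :=
    (hg.fderiv_right (m := 1) (by norm_num)).differentiableAt (by norm_num)
  have hfp : DifferentiableAt ℝ f p := hf.differentiableAt (by norm_num)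
  have hgp : DifferentiableAt ℝ g p := hg.differentiableAt (by norm_num)
  have hev : fderiv ℝ (fun x => f x * g x) =ᶠ[nhds p]
      fun x => f x • fderiv ℝ g x + g x • fderiv ℝ f x := by
    filter_upwards [hf.eventually (by simp), hg.eventually (by simp)] with x hx1 hx2
    exact fderiv_fun_mul (hx1.differentiableAt (by norm_num)) (hx2.differentiableAt (by norm_num))
  rw [hev.fderiv_eq]
  rw [((hfp.hasFDerivAt.fun_smul hg1.hasFDerivAt).fun_add
    (hgp.hasFDerivAt.fun_smul hf1.hasFDerivAt)).fderiv]
  simp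
  ring

theorem fderiv_fderiv_add {f g : V → ℝ} {p : V} (hf : ContDiffAt ℝ 2 f p)
    (hg : ContDiffAt ℝ 2 g p) :
    fderiv ℝ (fderiv ℝ (fun x => f x + g x)) p =
      fderiv ℝ (fderiv ℝ f) p + fderiv ℝ (fderiv ℝ g) p := by
  have hev : fderiv ℝ (fun x => f x + g x) =ᶠ[nhds p]
      fun x => fderiv ℝ f x + fderiv ℝ g x := by
    filter_upwards [hf.eventually (by simp), hg.eventually (by simp)] with x hx1 hx2
    exact fderiv_fun_add (hx1.differentiableAt (by norm_num)) (hx2.differentiableAt (by norm_num))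
  rw [hev.fderiv_eq]
  exact fderiv_fun_add
    ((hf.fderiv_right (m := 1) (by norm_num)).differentiableAt (by norm_num))
    ((hg.fderiv_right (m := 1) (by norm_num)).differentiableAt (by norm_num))

/-- A function with positive derivative in the direction `N` on a convex set increases in that
direction. -/
theorem lt_add_smul_of_fderiv_pos {g : V → ℝ} {N x : V} {s : ℝ} {U : Set V}
    (hg : ContDiff ℝ 1 g) (hU : Convex ℝ U) (hpos : ∀ y ∈ U, 0 < fderiv ℝ g y N)
    (hs : 0 < s) (hx : x ∈ U) (hxs : x + s • N ∈ U) : g x < g (x + s • N) := by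
  have hd : ∀ t : ℝ, HasDerivAt (fun t : ℝ => g (x + t • N)) (fderiv ℝ g (x + t • N) N) t := by
    intro t
    have h1 : HasDerivAt (fun t : ℝ => x + t • N) N t := by
      simpa using ((hasDerivAt_id t).smul_const N).const_add x
    exact ((hg.differentiable (by norm_num)) (x + t • N)).hasFDerivAt.comp_hasDerivAt t h1
  have hmono : StrictMonoOn (fun t : ℝ => g (x + t • N)) (Set.Icc 0 s) := by
    apply strictMonoOn_of_deriv_pos (convex_Icc 0 s)
    · exact fun t _ => (hd t).continuousAt.continuousWithinAt
    · intro t ht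
      rw [interior_Icc] at ht
      rw [(hd t).deriv]
      apply hpos
      have := hU.add_smul_sub_mem hx hxs (t := t / s) ⟨by have := ht.1; positivity, by
        rw [div_le_one hs]; exact ht.2.le⟩
      simpa [smul_smul, hs.ne'] using this
  simpa using hmono (Set.left_mem_Icc.2 hs.le) (Set.right_mem_Icc.2 hs.le) hs

end Calculus

/-! ### Hermitian forms on `ℂ²`. -/

/-- The Hermitian symmetrization `B(u, v) + B(iu, iv)` of a real bilinear form on `ℂ²`. -/
def herm (B : (ℂ × ℂ) →L[ℝ] (ℂ × ℂ) →L[ℝ] ℝ) (u v : ℂ × ℂ) : ℝ :=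
  B u v + B (Complex.I • u) (Complex.I • v)

theorem complex_smul_eq (a : ℂ) (v : ℂ × ℂ) : a • v = a.re • v + a.im • (Complex.I • v) := by
  conv_lhs => rw [← Complex.re_add_im a, add_smul, mul_smul]
  rfl

/-- A Hermitian form on `ℂ²` is nonnegative if it is positive on `N` and has nonnegative
determinant with respect to `T, N`. -/
theorem herm_nonneg {B : (ℂ × ℂ) →L[ℝ] (ℂ × ℂ) →L[ℝ] ℝ} (hB : ∀ u v, B u v = B v u)
    {T N : ℂ × ℂ} (hN : 0 < herm B N N)
    (hdet : herm B T N ^ 2 + herm B (Complex.I • T) N ^ 2 ≤ herm B T T * herm B N N) (a b : ℂ) :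
    0 ≤ herm B (a • T + b • N) (a • T + b • N) := by
  have hII : ∀ v : ℂ × ℂ, Complex.I • Complex.I • v = -v := fun v => by
    rw [smul_smul, Complex.I_mul_I]; simp
  -- Completion of the square: `B(N, N)` times the form is the squared modulus of a complex number
  -- plus `|a|²` times the determinant.
  have key : herm B N N * herm B (a • T + b • N) (a • T + b • N) =
      (herm B N N * b.re + a.re * herm B T N + a.im * herm B (Complex.I • T) N) ^ 2 +
      (herm B N N * b.im + a.im * herm B T N - a.re * herm B (Complex.I • T) N) ^ 2 +
      (a.re ^ 2 + a.im ^ 2) * (herm B T T * herm B N N -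
        (herm B T N ^ 2 + herm B (Complex.I • T) N ^ 2)) := by
    simp only [herm]
    rw [complex_smul_eq a, complex_smul_eq b]
    simp only [smul_add, smul_comm Complex.I (_ : ℝ), hII, map_add, map_smul, map_neg,
      add_apply, smul_apply, neg_apply,
      smul_eq_mul]
    rw [hB N T, hB (Complex.I • N) T, hB N (Complex.I • T), hB (Complex.I • N) (Complex.I • T),
      hB (Complex.I • T) T, hB (Complex.I • N) N]
    ring
  have h0 : 0 ≤ herm B N N * herm B (a • T + b • N) (a • T + b • N) := by
    rw [key]
    have := sub_nonneg.2 hdet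
    positivity
  exact nonneg_of_mul_nonneg_right h0 hN

/-! ### Truncation in one variable. -/

/-- A smooth convex nondecreasing function which is the identity on `[-ε, ∞)` and constant on
`(-∞, -2ε]`. -/
theorem exists_convex_truncation {ε : ℝ} (hε : 0 < ε) :
    ∃ X : ℝ → ℝ, ContDiff ℝ ∞ X ∧ (∀ s, -ε ≤ s → X s = s) ∧ (∀ s < 0, X s < 0) ∧
      (∀ s, 0 ≤ deriv X s) ∧ (∀ s, 0 ≤ deriv (deriv X) s) ∧ ∀ s ≤ -2 * ε, deriv X s = 0 := by
  -- `T` is the derivative of the function sought: it rises from `0` at `-2ε` to `1` at `-ε`. The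
  -- antiderivative is normalized to equal `-ε` at `-ε`.
  set T : ℝ → ℝ := fun t => Real.smoothTransition ((t + 2 * ε) / ε) with hT
  have hTs : ContDiff ℝ ∞ T :=
    Real.smoothTransition.contDiff.comp ((contDiff_id.add contDiff_const).div_const _)
  have hTm : Monotone T := fun a b hab => Real.smoothTransition.monotone (by gcongr)
  have hd : ∀ s, HasDerivAt (fun s => -ε + ∫ t in (-ε)..s, T t) (T s) s := fun s =>
    ((hTs.continuous.integral_hasStrictDerivAt _ s).hasDerivAt).const_add _
  have hd' : deriv (fun s => -ε + ∫ t in (-ε)..s, T t) = T := funext fun s => (hd s).deriv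
  have hmono : Monotone (fun s => -ε + ∫ t in (-ε)..s, T t) :=
    monotone_of_deriv_nonneg (fun s => (hd s).differentiableAt) fun s => by
      rw [hd']; exact Real.smoothTransition.nonneg _
  have hid : ∀ s, -ε ≤ s → -ε + ∫ t in (-ε)..s, T t = s := by
    intro s hs
    have : ∫ t in (-ε)..s, T t = ∫ t in (-ε)..s, (1 : ℝ) := by
      apply intervalIntegral.integral_congr
      intro t ht
      rw [Set.uIcc_of_le hs] at ht
      apply Real.smoothTransition.one_of_one_le
      rw [le_div_iff₀ hε]
      linarith [ht.1]
    rw [this]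
    simp
  refine ⟨_, contDiff_infty_iff_deriv.2 ⟨fun s => (hd s).differentiableAt, by rwa [hd']⟩, hid,
    ?_, ?_, ?_, ?_⟩
  · intro s hs
    rcases le_total (-ε) s with h | h
    · exact (hid s h).trans_lt hs
    · have h1 := hmono h
      have h2 := hid (-ε) le_rfl
      simp only at h1
      linarith
  · intro s
    rw [hd']
    exact Real.smoothTransition.nonneg _
  · intro s
    rw [hd']
    exact hTm.deriv_nonneg
  · intro s hs
    rw [hd']
    apply Real.smoothTransition.zero_of_nonpos
    apply div_nonpos_of_nonpos_of_nonneg _ hε.le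
    linarith

/-- A smooth change of the values of a defining function which truncates `-(-x) ^ τ` away from
`x = 0`. -/
theorem exists_truncation_rpow {τ ε : ℝ} (hτ : 0 < τ) (hε : 0 < ε) :
    ∃ g X : ℝ → ℝ, ContDiff ℝ ∞ g ∧ (∀ x < 0, g x < 0) ∧ (∀ᶠ x in nhds 0, g x = x) ∧
      (∀ x, 0 ≤ x → g x = x) ∧ ContDiff ℝ ∞ X ∧ (∀ x < 0, -(-g x) ^ τ = X (-(-x) ^ τ)) ∧
      (∀ s, 0 ≤ deriv X s) ∧ (∀ s, 0 ≤ deriv (deriv X) s) ∧ ∀ s ≤ -2 * ε, deriv X s = 0 := by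
  obtain ⟨X, hX, hXid, hXneg, hX1, hX2, hX0⟩ := exists_convex_truncation hε
  have hpow : ∀ x : ℝ, 0 < x → 0 < x ^ τ := fun x hx => Real.rpow_pos_of_pos hx _
  have hneg : ∀ x : ℝ, x < 0 → X (-(-x) ^ τ) < 0 := fun x hx =>
    hXneg _ (by have := hpow (-x) (by linarith); linarith)
  -- With `φ x = -(-x) ^ τ`, the witness `g` is the conjugate `φ⁻¹ ∘ X ∘ φ` on the negative axis.
  -- The bound on `x` says `φ x > -ε`, where `X` is the identity, so `g` continues smoothly by the
  -- identity across `0`.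
  have hgid : ∀ x : ℝ, -(ε ^ τ⁻¹) < x →
      (if x < 0 then -(-X (-(-x) ^ τ)) ^ τ⁻¹ else x) = x := by
    intro x hx
    split_ifs with h
    · have h1 : (-x) ^ τ ≤ ε := by
        have := Real.rpow_le_rpow (by linarith) (by linarith : -x ≤ ε ^ τ⁻¹) hτ.le
        rwa [Real.rpow_inv_rpow hε.le hτ.ne'] at this
      rw [hXid _ (by linarith), neg_neg, Real.rpow_rpow_inv (by linarith) hτ.ne', neg_neg]
    · rfl
  have hε' : 0 < ε ^ τ⁻¹ := Real.rpow_pos_of_pos hε _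
  have hev : ∀ x : ℝ, -(ε ^ τ⁻¹) < x →
      (fun x => if x < 0 then -(-X (-(-x) ^ τ)) ^ τ⁻¹ else x) =ᶠ[nhds x] id := by
    intro x hx
    filter_upwards [lt_mem_nhds hx] with y hy
    exact hgid y hy
  refine ⟨fun x => if x < 0 then -(-X (-(-x) ^ τ)) ^ τ⁻¹ else x, X, ?_, ?_, ?_, ?_, hX, ?_, hX1,
    hX2, hX0⟩
  · rw [contDiff_iff_contDiffAt]
    intro x
    rcases lt_or_ge x 0 with hx | hx
    · have h1 : (fun x => if x < 0 then -(-X (-(-x) ^ τ)) ^ τ⁻¹ else x) =ᶠ[nhds x]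
          fun x => -(-X (-(-x) ^ τ)) ^ τ⁻¹ := by
        filter_upwards [gt_mem_nhds hx] with y hy
        rw [if_pos hy]
      refine ContDiffAt.congr_of_eventuallyEq ?_ h1
      have h2 : ContDiffAt ℝ ∞ (fun x : ℝ => -(-x) ^ τ) x :=
        (contDiffAt_id.neg.rpow_const_of_ne (by simpa using hx.ne)).neg
      have h3 : ContDiffAt ℝ ∞ (fun x : ℝ => X (-(-x) ^ τ)) x :=
        hX.contDiffAt.comp x h2
      exact (h3.neg.rpow_const_of_ne (by simpa using (hneg x hx).ne)).neg
    · exact contDiffAt_id.congr_of_eventuallyEq (hev x (by linarith))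
  · intro x hx
    simp only [hx, if_true]
    have := Real.rpow_pos_of_pos (neg_pos.2 (hneg x hx)) τ⁻¹
    linarith
  · exact hev 0 (by linarith)
  · intro x hx
    simp [not_lt.2 hx]
  · intro x hx
    simp only [hx, if_true, neg_neg]
    rw [Real.rpow_inv_rpow (by linarith [hneg x hx]) hτ.ne', neg_neg]

/-! ### Functions vanishing on a simple smooth curve. -/

theorem exists_dual_of_linearIndependent {V : Type*} [NormedAddCommGroup V] [NormedSpace ℝ V]
    [FiniteDimensional ℝ V] {u T : V} (h : LinearIndependent ℝ ![u, T]) :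
    ∃ m : V →L[ℝ] ℝ, m u = 0 ∧ m T = 1 := by
  have hT : T ∉ Submodule.span ℝ {u} := by
    intro hT
    obtain ⟨a, ha⟩ := Submodule.mem_span_singleton.1 hT
    have := LinearIndependent.pair_iff.1 h a (-1) (by rw [ha]; simp)
    simp at this
  obtain ⟨f, hf, hf0⟩ := Submodule.exists_dual_map_eq_bot_of_notMem hT inferInstance
  refine ⟨(f T)⁻¹ • LinearMap.toContinuousLinearMap f, ?_, ?_⟩
  · have : f u ∈ (Submodule.span ℝ {u}).map f :=
      Submodule.mem_map_of_mem (Submodule.mem_span_singleton_self u)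
    rw [hf0, Submodule.mem_bot] at this
    simp [this]
  · simp [inv_mul_cancel₀ hf]

/-- Points of a simple smooth curve near `γ t₀` have parameters near `t₀`. -/
theorem IsSimpleSmoothCurve.exists_near {γ : ℝ → ℂ × ℂ} {r : ℝ} (hγ : IsSimpleSmoothCurve γ r)
    {t₀ : ℝ} (ht₀ : t₀ ∈ Set.Icc 0 r) {ε : ℝ} (hε : 0 < ε) :
    ∀ᶠ q in nhds (γ t₀), q ∈ γ '' Set.Icc 0 r → ∃ s ∈ Metric.ball t₀ ε, γ s = q := by
  -- `K` collects the parameters that stay away from those of the point `γ t₀`. Its image is compact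
  -- and misses `γ t₀`, hence misses a neighbourhood of it.
  have hsub : ∃ K : Set ℝ, IsCompact K ∧ γ t₀ ∉ γ '' K ∧
      ∀ t ∈ Set.Icc 0 r, t ∉ K → ∃ s ∈ Metric.ball t₀ ε, γ s = γ t := by
    rcases hγ.simple with hinj | ⟨hper, hinj⟩
    · refine ⟨Set.Icc 0 r \ Metric.ball t₀ ε, isCompact_Icc.diff Metric.isOpen_ball, ?_, ?_⟩
      · rintro ⟨t, ⟨ht, htb⟩, h⟩
        exact htb (hinj ht ht₀ h ▸ Metric.mem_ball_self hε)
      · intro t ht htK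
        exact ⟨t, by_contra fun h => htK ⟨ht, h⟩, rfl⟩
    -- On a closed curve `t₀` may be an end of `[0, r]`, so parameters near `t₀ + r` and `t₀ - r`
    -- must be removed as well.
    · refine ⟨((Set.Icc 0 r \ Metric.ball t₀ ε) \ Metric.ball (t₀ + r) ε) \
        Metric.ball (t₀ - r) ε, ((isCompact_Icc.diff Metric.isOpen_ball).diff
          Metric.isOpen_ball).diff Metric.isOpen_ball, ?_, ?_⟩
      · rintro ⟨t, ⟨⟨⟨ht, h1⟩, h2⟩, h3⟩, h⟩
        have key : ∀ t ∈ Set.Icc 0 r, ∃ t' ∈ Set.Ico 0 r, γ t' = γ t ∧ (t' = t ∨ t' = t - r) := by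
          intro t ht
          rcases ht.2.lt_or_eq with h | h
          · exact ⟨t, ⟨ht.1, h⟩, rfl, Or.inl rfl⟩
          · refine ⟨t - r, ⟨by linarith, by linarith [hγ.length_pos]⟩, hper.sub_eq t, Or.inr rfl⟩
        obtain ⟨a, ha, ha', hat⟩ := key t ht
        obtain ⟨b, hb, hb', hbt⟩ := key t₀ ht₀
        have hab := hinj ha hb (by rw [ha', hb', h])
        have hc : t = t₀ ∨ t = t₀ + r ∨ t = t₀ - r := by
          rcases hat with hat | hat <;> rcases hbt with hbt | hbt
          · left; linarith
          · right; right; linarith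
          · right; left; linarith
          · left; linarith
        rcases hc with rfl | rfl | rfl
        · exact h1 (Metric.mem_ball_self hε)
        · exact h2 (Metric.mem_ball_self hε)
        · exact h3 (Metric.mem_ball_self hε)
      · intro t ht htK
        by_cases h1 : t ∈ Metric.ball t₀ ε
        · exact ⟨t, h1, rfl⟩
        by_cases h2 : t ∈ Metric.ball (t₀ + r) ε
        · refine ⟨t - r, ?_, hper.sub_eq t⟩
          rw [Metric.mem_ball, Real.dist_eq] at h2 ⊢
          convert h2 using 2
          ring
        by_cases h3 : t ∈ Metric.ball (t₀ - r) ε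
        · refine ⟨t + r, ?_, hper t⟩
          rw [Metric.mem_ball, Real.dist_eq] at h3 ⊢
          convert h3 using 2
          ring
        exact absurd ⟨⟨⟨ht, h1⟩, h2⟩, h3⟩ htK
  obtain ⟨K, hK, h0, hmem⟩ := hsub
  have hcl : IsClosed (γ '' K) := (hK.image hγ.smooth.continuous).isClosed
  filter_upwards [hcl.isOpen_compl.mem_nhds h0] with q hq
  rintro ⟨t, ht, rfl⟩
  exact hmem t ht fun htK => hq ⟨t, htK, rfl⟩

/-- A smooth function of one variable with nonzero derivative has a smooth local left inverse. -/
theorem exists_smooth_left_inverse {c : ℝ → ℝ} (hc : ContDiff ℝ ∞ c) {t₀ : ℝ}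
    (h0 : deriv c t₀ ≠ 0) :
    ∃ h : ℝ → ℝ, (∀ᶠ s in nhds t₀, h (c s) = s) ∧ ∀ᶠ y in nhds (c t₀), ContDiffAt ℝ ∞ h y := by
  have hd : ∀ t, HasDerivAt c (deriv c t) t := fun t =>
    (hc.differentiable (by simp) t).hasDerivAt
  have hs : HasStrictDerivAt c (deriv c t₀) t₀ := hc.contDiffAt.hasStrictDerivAt (by simp)
  have hs' := hs.hasStrictFDerivAt_equiv h0
  set e := hs'.toOpenPartialHomeomorph c with he
  have hec : ⇑e = c := hs'.toOpenPartialHomeomorph_coe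
  have hmem : t₀ ∈ e.source := hs'.mem_toOpenPartialHomeomorph_source
  have hct : c t₀ ∈ e.target := hec ▸ e.map_source hmem
  have hinv : e.symm (c t₀) = t₀ := by rw [← hec]; exact e.left_inv hmem
  refine ⟨e.symm, ?_, ?_⟩
  · filter_upwards [e.open_source.mem_nhds hmem] with s hs
    rw [← hec]
    exact e.left_inv hs
  · have hcont : ContinuousAt e.symm (c t₀) := e.symm.continuousAt hct
    have hdc : Continuous (deriv c) := hc.continuous_deriv (by simp)
    have h1 : ∀ᶠ y in nhds (c t₀), deriv c (e.symm y) ≠ 0 := by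
      apply (hdc.continuousAt.comp hcont).eventually_ne
      simpa [hinv] using h0
    filter_upwards [h1, e.open_target.mem_nhds hct] with y hy hyt
    refine e.contDiffAt_symm_deriv hy hyt ?_ ?_
    · rw [hec]; exact hd _
    · rw [hec]; exact hc.contDiffAt

/-- Near each of its points, a simple smooth curve has a smooth function vanishing on it whose
derivative in a given transversal direction is nonzero. -/
theorem IsSimpleSmoothCurve.exists_vanishing {γ : ℝ → ℂ × ℂ} {r : ℝ}
    (hγ : IsSimpleSmoothCurve γ r) {t₀ : ℝ} (ht₀ : t₀ ∈ Set.Icc 0 r) {T : ℂ × ℂ}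
    (hT : LinearIndependent ℝ ![deriv γ t₀, T]) :
    ∃ f : ℂ × ℂ → ℝ, ContDiff ℝ ∞ f ∧ (∀ q ∈ γ '' Set.Icc 0 r, f q = 0) ∧
      fderiv ℝ f (γ t₀) T = 1 := by
  obtain ⟨m, hm0, hm1⟩ := exists_dual_of_linearIndependent hT
  obtain ⟨l, -, hl1⟩ := exists_dual_of_linearIndependent (LinearIndependent.pair_symm_iff.1 hT)
  have hdγ : ∀ t, HasDerivAt γ (deriv γ t) t := fun t =>
    (hγ.smooth.differentiable (by simp) t).hasDerivAt
  obtain ⟨h, hinv, hsm⟩ := exists_smooth_left_inverse (c := fun t => l (γ t)) (t₀ := t₀)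
    (l.contDiff.comp hγ.smooth) (by
      have h1 : HasDerivAt (fun t => l (γ t)) _ t₀ := l.hasFDerivAt.comp_hasDerivAt t₀ (hdγ t₀)
      rw [h1.deriv, hl1]
      exact one_ne_zero)
  obtain ⟨ε, hε, hεinv⟩ := Metric.eventually_nhds_iff_ball.1 hinv
  have hsm' : ∀ᶠ q in nhds (γ t₀), ContDiffAt ℝ ∞ h (l q) :=
    l.continuous.continuousAt.eventually hsm
  -- Inside this ball `h ∘ l` is smooth and recovers a parameter near `t₀` of each point of the
  -- curve, so no other branch of the curve interferes.
  obtain ⟨δ, hδ, hball⟩ := Metric.eventually_nhds_iff_ball.1 (hsm'.and (hγ.exists_near ht₀ hε))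
  let χ : ContDiffBump (γ t₀) := ⟨δ / 4, δ / 2, by positivity, by linarith⟩
  have hF : ∀ q, ContDiffAt ℝ ∞ h (l q) →
      ContDiffAt ℝ ∞ (fun q => m q - m (γ (h (l q)))) q := fun q hq =>
    m.contDiff.contDiffAt.sub (m.contDiff.contDiffAt.comp q (hγ.smooth.contDiffAt.comp q
      (hq.comp q l.contDiff.contDiffAt)))
  -- `γ (h (l q))` is the point of the curve with the same `l`-coordinate as `q`. The difference
  -- vanishes on the curve, and its derivative along `T` is `m T = 1` because `m` kills `γ'(t₀)`;
  -- `χ` makes it global.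
  refine ⟨fun q => χ q * (m q - m (γ (h (l q)))), ?_, ?_, ?_⟩
  · rw [contDiff_iff_contDiffAt]
    intro q
    by_cases hq : q ∈ Metric.ball (γ t₀) δ
    · exact χ.contDiffAt.mul (hF q (hball q hq).1)
    · have : (fun q => χ q * (m q - m (γ (h (l q))))) =ᶠ[nhds q] fun _ => 0 := by
        have : q ∉ Metric.closedBall (γ t₀) (δ / 2) := fun h =>
          hq (Metric.closedBall_subset_ball (by linarith) h)
        filter_upwards [Metric.isClosed_closedBall.isOpen_compl.mem_nhds this] with y hy
        rw [χ.zero_of_le_dist, zero_mul]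
        rw [Set.mem_compl_iff, Metric.mem_closedBall, not_le] at hy
        exact hy.le
      exact contDiffAt_const.congr_of_eventuallyEq this
  · intro q hq
    by_cases hqb : q ∈ Metric.ball (γ t₀) δ
    · obtain ⟨s, hs, rfl⟩ := (hball q hqb).2 hq
      simp [hεinv s hs]
    · rw [Metric.mem_ball, not_lt] at hqb
      have : δ / 2 ≤ dist q (γ t₀) := by linarith
      simp [χ.zero_of_le_dist this]
  · have hev : (fun q => χ q * (m q - m (γ (h (l q))))) =ᶠ[nhds (γ t₀)]
        fun q => m q - m (γ (h (l q))) := by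
      filter_upwards [χ.eventuallyEq_one] with y hy
      rw [hy]
      simp
    rw [hev.fderiv_eq]
    have hh0 : h (l (γ t₀)) = t₀ := hinv.self_of_nhds
    have hh : HasDerivAt h (deriv h (l (γ t₀))) (l (γ t₀)) :=
      (hsm.self_of_nhds.differentiableAt (by simp)).hasDerivAt
    have h1 : HasDerivAt (fun y => m (γ (h y))) (deriv h (l (γ t₀)) • m (deriv γ t₀))
        (l (γ t₀)) := by
      have := (hdγ (h (l (γ t₀)))).scomp _ hh
      rw [hh0] at this
      have h2 : HasDerivAt (fun y => m (γ (h y))) _ (l (γ t₀)) :=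
        m.hasFDerivAt.comp_hasDerivAt _ this
      rwa [map_smul] at h2
    have h2 := m.hasFDerivAt.sub (h1.comp_hasFDerivAt (γ t₀) l.hasFDerivAt)
    have h3 : HasFDerivAt (fun q => m q - m (γ (h (l q)))) _ (γ t₀) := h2
    rw [h3.fderiv]
    simp [hm0, hm1]

/-! ### The tangential and normal fields and the Levi form. -/

/-- The tangential vector field `ρ_w ∂/∂z - ρ_z ∂/∂w`. -/
def tangent (ρ : ℂ × ℂ → ℝ) (p : ℂ × ℂ) : ℂ × ℂ := (wirtingerW ρ p, -wirtingerZ ρ p)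

/-- The complex normal vector field, that is, the conjugate of the complex gradient. -/
def normal (ρ : ℂ × ℂ → ℝ) (p : ℂ × ℂ) : ℂ × ℂ :=
  (starRingEnd ℂ (wirtingerZ ρ p), starRingEnd ℂ (wirtingerW ρ p))

theorem fderiv_apply_eq_wirtinger (f : ℂ × ℂ → ℝ) (p v : ℂ × ℂ) :
    fderiv ℝ f p v = 2 * (wirtingerZ f p * v.1 + wirtingerW f p * v.2).re := by
  have hv : v = v.1.re • ((1, 0) : ℂ × ℂ) + v.1.im • ((Complex.I, 0) : ℂ × ℂ) +
      v.2.re • ((0, 1) : ℂ × ℂ) + v.2.im • ((0, Complex.I) : ℂ × ℂ) := by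
    ext <;> simp
  conv_lhs => rw [hv]
  simp only [map_add, map_smul, smul_eq_mul, wirtingerZ, wirtingerW]
  simp
  ring

theorem fderiv_tangent (ρ : ℂ × ℂ → ℝ) (p : ℂ × ℂ) : fderiv ℝ ρ p (tangent ρ p) = 0 := by
  rw [fderiv_apply_eq_wirtinger, tangent]
  simp
  ring

theorem fderiv_I_smul_tangent (ρ : ℂ × ℂ → ℝ) (p : ℂ × ℂ) :
    fderiv ℝ ρ p (Complex.I • tangent ρ p) = 0 := by
  rw [fderiv_apply_eq_wirtinger, tangent]
  simp
  ring

theorem fderiv_normal (ρ : ℂ × ℂ → ℝ) (p : ℂ × ℂ) :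
    fderiv ℝ ρ p (normal ρ p) = 2 * (‖wirtingerZ ρ p‖ ^ 2 + ‖wirtingerW ρ p‖ ^ 2) := by
  rw [fderiv_apply_eq_wirtinger, normal]
  simp [Complex.sq_norm, Complex.normSq_apply]

theorem fderiv_normal_pos {ρ : ℂ × ℂ → ℝ} {p : ℂ × ℂ} (h : fderiv ℝ ρ p ≠ 0) :
    0 < fderiv ℝ ρ p (normal ρ p) := by
  rw [fderiv_normal]
  by_contra hn
  have hz : ‖wirtingerZ ρ p‖ = 0 := by
    nlinarith [sq_nonneg ‖wirtingerZ ρ p‖, sq_nonneg ‖wirtingerW ρ p‖]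
  have hw : ‖wirtingerW ρ p‖ = 0 := by
    nlinarith [sq_nonneg ‖wirtingerZ ρ p‖, sq_nonneg ‖wirtingerW ρ p‖]
  rw [norm_eq_zero] at hz hw
  apply h
  ext v
  · simp [fderiv_apply_eq_wirtinger, hz]
  · simp [fderiv_apply_eq_wirtinger, hw]

/-- Cramer's rule: the frame has determinant `|ρ_z|² + |ρ_w|²`, nonzero where the gradient is. -/
theorem exists_eq_tangent_add_normal {ρ : ℂ × ℂ → ℝ} {p : ℂ × ℂ}
    (h : 0 < fderiv ℝ ρ p (normal ρ p)) (v : ℂ × ℂ) :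
    ∃ a b : ℂ, v = a • tangent ρ p + b • normal ρ p := by
  rw [fderiv_normal] at h
  set z := wirtingerZ ρ p with hz
  set w := wirtingerW ρ p with hw
  have hn : z * starRingEnd ℂ z + w * starRingEnd ℂ w ≠ 0 := by
    rw [Complex.mul_conj, Complex.mul_conj, ← Complex.sq_norm, ← Complex.sq_norm,
      ← Complex.ofReal_add]
    exact Complex.ofReal_ne_zero.2 (by linarith)
  refine ⟨(starRingEnd ℂ w * v.1 - starRingEnd ℂ z * v.2) /
      (z * starRingEnd ℂ z + w * starRingEnd ℂ w),
    (z * v.1 + w * v.2) / (z * starRingEnd ℂ z + w * starRingEnd ℂ w), ?_⟩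
  ext1
  · simp only [tangent, normal, Prod.fst_add, Prod.smul_fst, smul_eq_mul, ← hz, ← hw]
    rw [div_mul_eq_mul_div, div_mul_eq_mul_div, ← add_div, eq_div_iff hn]
    ring
  · simp only [tangent, normal, Prod.snd_add, Prod.smul_snd, smul_eq_mul, ← hz, ← hw]
    rw [div_mul_eq_mul_div, div_mul_eq_mul_div, ← add_div, eq_div_iff hn]
    ring

theorem contDiff_wirtinger {ρ : ℂ × ℂ → ℝ} (hρ : ContDiff ℝ ∞ ρ) :
    ContDiff ℝ ∞ (wirtingerZ ρ) ∧ ContDiff ℝ ∞ (wirtingerW ρ) := by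
  have h : ∀ v : ℂ × ℂ, ContDiff ℝ ∞ fun p => (fderiv ℝ ρ p v : ℂ) := fun v =>
    Complex.ofRealCLM.contDiff.comp ((hρ.fderiv_right (by simp)).clm_apply contDiff_const)
  exact ⟨contDiff_const.mul ((h _).sub (contDiff_const.mul (h _))),
    contDiff_const.mul ((h _).sub (contDiff_const.mul (h _)))⟩

theorem contDiff_tangent {ρ : ℂ × ℂ → ℝ} (hρ : ContDiff ℝ ∞ ρ) : ContDiff ℝ ∞ (tangent ρ) :=
  (contDiff_wirtinger hρ).2.prodMk (contDiff_wirtinger hρ).1.neg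

theorem contDiff_normal {ρ : ℂ × ℂ → ℝ} (hρ : ContDiff ℝ ∞ ρ) : ContDiff ℝ ∞ (normal ρ) :=
  (Complex.conjCLE.contDiff.comp (contDiff_wirtinger hρ).1).prodMk
    (Complex.conjCLE.contDiff.comp (contDiff_wirtinger hρ).2)

theorem contDiff_herm {n : ℕ∞ω} {B : ℂ × ℂ → (ℂ × ℂ) →L[ℝ] (ℂ × ℂ) →L[ℝ] ℝ} {u v : ℂ × ℂ → ℂ × ℂ}
    (hB : ContDiff ℝ n B) (hu : ContDiff ℝ n u) (hv : ContDiff ℝ n v) :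
    ContDiff ℝ n fun p => herm (B p) (u p) (v p) :=
  ((hB.clm_apply hu).clm_apply hv).add
    ((hB.clm_apply (hu.const_smul Complex.I)).clm_apply (hv.const_smul Complex.I))

/-- The Levi form on the tangential field without normalization. -/
def levi (ρ : ℂ × ℂ → ℝ) (p : ℂ × ℂ) : ℝ :=
  herm (fderiv ℝ (fderiv ℝ ρ) p) (tangent ρ p) (tangent ρ p)

theorem contDiff_levi {ρ : ℂ × ℂ → ℝ} (hρ : ContDiff ℝ ∞ ρ) : ContDiff ℝ ∞ (levi ρ) :=
  contDiff_herm ((hρ.fderiv_right (m := ∞) (by simp)).fderiv_right (by simp))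
    (contDiff_tangent hρ) (contDiff_tangent hρ)

theorem tangentL_eq_smul_tangent {ρ : ℂ × ℂ → ℝ} {p : ℂ × ℂ} (h : fderiv ℝ ρ p ≠ 0) :
    ∃ s : ℝ, 0 < s ∧ tangentL ρ p = s • tangent ρ p := by
  refine ⟨_, inv_pos.2 (Real.sqrt_pos.2 ?_), rfl⟩
  have := fderiv_normal_pos h
  rw [fderiv_normal] at this
  linarith

/-- Sign and zeros of the Levi form are unaffected by dropping the normalization, while `tangent ρ`
is smooth on all of `ℂ²`, so that `levi ρ` can be differentiated across the boundary. -/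
theorem complexHessian_tangentL {ρ : ℂ × ℂ → ℝ} {p : ℂ × ℂ} (h : fderiv ℝ ρ p ≠ 0) :
    ∃ s : ℝ, 0 < s ∧ complexHessian ρ p (tangentL ρ p) = s * levi ρ p := by
  obtain ⟨s, hs, hL⟩ := tangentL_eq_smul_tangent h
  refine ⟨1 / 4 * s ^ 2, by positivity, ?_⟩
  rw [hL, complexHessian, levi, herm, smul_comm Complex.I s]
  simp
  ring

/-! ### The Hessian form near the boundary and its positivity. -/

/-- Up to a positive factor, the Hessian of `-(-ρ e ^ ψ) ^ τ`, see
`complexHessian_neg_rpow_mul_exp`. -/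
def collarForm (τ : ℝ) (ρ ψ : ℂ × ℂ → ℝ) (p : ℂ × ℂ) : (ℂ × ℂ) →L[ℝ] (ℂ × ℂ) →L[ℝ] ℝ :=
  (-ρ p) • fderiv ℝ (fderiv ℝ ρ) p +
    (τ * -ρ p) • ((fderiv ℝ ρ p).smulRight (fderiv ℝ ψ p) +
      (fderiv ℝ ψ p).smulRight (fderiv ℝ ρ p)) -
    (ρ p ^ 2) • (fderiv ℝ (fderiv ℝ ψ) p + τ • (fderiv ℝ ψ p).smulRight (fderiv ℝ ψ p)) +
    (1 - τ) • (fderiv ℝ ρ p).smulRight (fderiv ℝ ρ p)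

theorem collarForm_apply (τ : ℝ) (ρ ψ : ℂ × ℂ → ℝ) (p u v : ℂ × ℂ) :
    collarForm τ ρ ψ p u v = -ρ p * fderiv ℝ (fderiv ℝ ρ) p u v +
      τ * -ρ p * (fderiv ℝ ρ p u * fderiv ℝ ψ p v + fderiv ℝ ψ p u * fderiv ℝ ρ p v) -
      ρ p ^ 2 * (fderiv ℝ (fderiv ℝ ψ) p u v + τ * (fderiv ℝ ψ p u * fderiv ℝ ψ p v)) +
      (1 - τ) * (fderiv ℝ ρ p u * fderiv ℝ ρ p v) := by
  simp [collarForm]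
  ring

theorem collarForm_symm (τ : ℝ) {ρ ψ : ℂ × ℂ → ℝ} (hρ : ContDiff ℝ ∞ ρ) (hψ : ContDiff ℝ ∞ ψ)
    (p u v : ℂ × ℂ) : collarForm τ ρ ψ p u v = collarForm τ ρ ψ p v u := by
  have h1 := (hρ.contDiffAt (x := p)).isSymmSndFDerivAt
    (by simpa using ENat.LEInfty.out)
  have h2 := (hψ.contDiffAt (x := p)).isSymmSndFDerivAt
    (by simpa using ENat.LEInfty.out)
  rw [collarForm_apply, collarForm_apply, h1 u v, h2 u v]
  ring

/-- The part of `collarForm` on the tangential direction that vanishes to second order. -/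
def tangentCoeff (τ : ℝ) (ρ ψ : ℂ × ℂ → ℝ) (p : ℂ × ℂ) : ℝ :=
  -(herm (fderiv ℝ (fderiv ℝ ψ) p) (tangent ρ p) (tangent ρ p) +
    τ * (fderiv ℝ ψ p (tangent ρ p) ^ 2 + fderiv ℝ ψ p (Complex.I • tangent ρ p) ^ 2))

/-- The mixed terms of `collarForm`, divided by `-ρ`. -/
def mixedCoeff (τ : ℝ) (ρ ψ : ℂ × ℂ → ℝ) (p u v : ℂ × ℂ) : ℝ :=
  herm (fderiv ℝ (fderiv ℝ ρ) p) u v +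
    τ * (fderiv ℝ ψ p u * fderiv ℝ ρ p v +
      fderiv ℝ ψ p (Complex.I • u) * fderiv ℝ ρ p (Complex.I • v)) +
    ρ p * (herm (fderiv ℝ (fderiv ℝ ψ) p) u v + τ * (fderiv ℝ ψ p u * fderiv ℝ ψ p v +
      fderiv ℝ ψ p (Complex.I • u) * fderiv ℝ ψ p (Complex.I • v)))

theorem herm_collarForm_tangent (τ : ℝ) (ρ ψ : ℂ × ℂ → ℝ) (p : ℂ × ℂ) :
    herm (collarForm τ ρ ψ p) (tangent ρ p) (tangent ρ p) =
      -ρ p * (levi ρ p + -ρ p * tangentCoeff τ ρ ψ p) := by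
  simp only [levi, tangentCoeff, herm, collarForm_apply, fderiv_tangent, fderiv_I_smul_tangent]
  ring

/-- The only term of `collarForm` without a factor `ρ` is `(1 - τ) dρ ⊗ dρ`, and it vanishes on
complex tangent vectors. -/
theorem herm_collarForm_mixed (τ : ℝ) (ρ ψ : ℂ × ℂ → ℝ) (p v : ℂ × ℂ) {u : ℂ × ℂ}
    (hu : fderiv ℝ ρ p u = 0) (hIu : fderiv ℝ ρ p (Complex.I • u) = 0) :
    herm (collarForm τ ρ ψ p) u v = -ρ p * mixedCoeff τ ρ ψ p u v := by
  simp only [mixedCoeff, herm, collarForm_apply, hu, hIu]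
  ring

theorem continuous_herm {f : ℂ × ℂ → ℝ} (hf : ContDiff ℝ ∞ f) {u v : ℂ × ℂ → ℂ × ℂ}
    (hu : Continuous u) (hv : Continuous v) :
    Continuous fun p => herm (fderiv ℝ (fderiv ℝ f) p) (u p) (v p) := by
  have : Continuous (fderiv ℝ (fderiv ℝ f)) :=
    (hf.fderiv_right (m := ∞) (by simp)).continuous_fderiv (by simp)
  exact contDiff_zero.1 (contDiff_herm (contDiff_zero.2 this) (contDiff_zero.2 hu)
    (contDiff_zero.2 hv))

theorem continuous_fderiv_apply {f : ℂ × ℂ → ℝ} (hf : ContDiff ℝ ∞ f) {u : ℂ × ℂ → ℂ × ℂ}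
    (hu : Continuous u) : Continuous fun p => fderiv ℝ f p (u p) :=
  (hf.continuous_fderiv (by simp)).clm_apply hu

theorem continuous_tangentCoeff (τ : ℝ) {ρ ψ : ℂ × ℂ → ℝ} (hρ : ContDiff ℝ ∞ ρ)
    (hψ : ContDiff ℝ ∞ ψ) : Continuous (tangentCoeff τ ρ ψ) := by
  have hT := (contDiff_tangent hρ).continuous
  exact ((continuous_herm hψ hT hT).add (continuous_const.mul
    (((continuous_fderiv_apply hψ hT).pow 2).add
      ((continuous_fderiv_apply hψ (hT.const_smul Complex.I)).pow 2)))).neg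

theorem continuous_mixedCoeff (τ : ℝ) {ρ ψ : ℂ × ℂ → ℝ} (hρ : ContDiff ℝ ∞ ρ)
    (hψ : ContDiff ℝ ∞ ψ) {u v : ℂ × ℂ → ℂ × ℂ} (hu : Continuous u) (hv : Continuous v) :
    Continuous fun p => mixedCoeff τ ρ ψ p (u p) (v p) := by
  have hIu : Continuous fun p => Complex.I • u p := hu.const_smul Complex.I
  have hIv : Continuous fun p => Complex.I • v p := hv.const_smul Complex.I
  have h1 := continuous_herm hρ hu hv
  have h2 := continuous_herm hψ hu hv
  have h3 := continuous_fderiv_apply hψ hu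
  have h4 := continuous_fderiv_apply hψ hv
  have h5 := continuous_fderiv_apply hψ hIu
  have h6 := continuous_fderiv_apply hψ hIv
  have h7 := continuous_fderiv_apply hρ hv
  have h8 := continuous_fderiv_apply hρ hIv
  have h9 := hρ.continuous
  unfold mixedCoeff
  fun_prop

theorem continuous_collarForm (τ : ℝ) {ρ ψ : ℂ × ℂ → ℝ} (hρ : ContDiff ℝ ∞ ρ)
    (hψ : ContDiff ℝ ∞ ψ) {u v : ℂ × ℂ → ℂ × ℂ} (hu : Continuous u) (hv : Continuous v) :
    Continuous fun p => collarForm τ ρ ψ p (u p) (v p) := by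
  have h1 := (((hρ.fderiv_right (m := ∞) (by simp)).continuous_fderiv (by simp)).clm_apply
    hu).clm_apply hv
  have h2 := (((hψ.fderiv_right (m := ∞) (by simp)).continuous_fderiv (by simp)).clm_apply
    hu).clm_apply hv
  have h3 := continuous_fderiv_apply hψ hu
  have h4 := continuous_fderiv_apply hψ hv
  have h5 := continuous_fderiv_apply hρ hu
  have h6 := continuous_fderiv_apply hρ hv
  have h7 := hρ.continuous
  simp only [collarForm_apply]
  fun_prop

/-- The squared norm of `mixedCoeff` at a boundary point where `ψ` has no tangential derivative. -/
def mixedNormSq (ρ : ℂ × ℂ → ℝ) (p : ℂ × ℂ) : ℝ :=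
  herm (fderiv ℝ (fderiv ℝ ρ) p) (tangent ρ p) (normal ρ p) ^ 2 +
    herm (fderiv ℝ (fderiv ℝ ρ) p) (Complex.I • tangent ρ p) (normal ρ p) ^ 2

/-- `fderiv ℝ ρ p (normal ρ p) ^ 2`, in Hermitian form. -/
def normalSq (ρ : ℂ × ℂ → ℝ) (p : ℂ × ℂ) : ℝ :=
  fderiv ℝ ρ p (normal ρ p) ^ 2 + fderiv ℝ ρ p (Complex.I • normal ρ p) ^ 2

/-- Only `(1 - τ) dρ ⊗ dρ` survives on the boundary; this is where `τ < 1` gives strict positivity.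
-/
theorem herm_collarForm_normal_of_eq_zero (τ : ℝ) {ρ : ℂ × ℂ → ℝ} (ψ : ℂ × ℂ → ℝ) {p : ℂ × ℂ}
    (hp : ρ p = 0) :
    herm (collarForm τ ρ ψ p) (normal ρ p) (normal ρ p) = (1 - τ) * normalSq ρ p := by
  simp only [normalSq, herm, collarForm_apply, hp]
  ring

/-- Near a boundary point, `collarForm` is positive semidefinite if the Levi form is positive at
that point, or if `ψ` is sufficiently concave in the tangential direction. -/
theorem eventually_collarForm_nonneg {τ : ℝ} (hτ : τ < 1) {ρ ψ : ℂ × ℂ → ℝ}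
    (hρ : ContDiff ℝ ∞ ρ) (hψ : ContDiff ℝ ∞ ψ) {p : ℂ × ℂ} (hp : ρ p = 0)
    (hd : fderiv ℝ ρ p ≠ 0)
    (h : 0 < levi ρ p ∨ (fderiv ℝ ψ p (tangent ρ p) = 0 ∧
      fderiv ℝ ψ p (Complex.I • tangent ρ p) = 0 ∧
      ∃ D : ℝ, (∀ᶠ q in nhds p, ρ q < 0 → D * ρ q ≤ levi ρ q) ∧
        mixedNormSq ρ p < (tangentCoeff τ ρ ψ p - D) * ((1 - τ) * normalSq ρ p))) :
    ∀ᶠ q in nhds p, ρ q < 0 → ∀ v, 0 ≤ herm (collarForm τ ρ ψ q) v v := by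
  have hT := (contDiff_tangent hρ).continuous
  have hN := (contDiff_normal hρ).continuous
  have hIT : Continuous fun q => Complex.I • tangent ρ q := hT.const_smul Complex.I
  have hIN : Continuous fun q => Complex.I • normal ρ q := hN.const_smul Complex.I
  set G : ℂ × ℂ → ℝ := fun q => herm (collarForm τ ρ ψ q) (normal ρ q) (normal ρ q) with hG
  set b : ℂ × ℂ → ℝ := fun q => mixedCoeff τ ρ ψ q (tangent ρ q) (normal ρ q) ^ 2 +
    mixedCoeff τ ρ ψ q (Complex.I • tangent ρ q) (normal ρ q) ^ 2 with hb
  have hGc : Continuous G :=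
    (continuous_collarForm τ hρ hψ hN hN).add (continuous_collarForm τ hρ hψ hIN hIN)
  have hbc : Continuous b := ((continuous_mixedCoeff τ hρ hψ hT hN).pow 2).add
    ((continuous_mixedCoeff τ hρ hψ hIT hN).pow 2)
  have hA := continuous_tangentCoeff τ hρ hψ
  have hl := (contDiff_levi hρ).continuous
  have hρc := hρ.continuous
  have hnp : 0 < normalSq ρ p := by
    have := fderiv_normal_pos hd
    unfold normalSq
    positivity
  have hGp : 0 < G p := by
    simp only [hG, herm_collarForm_normal_of_eq_zero τ ψ hp]
    have : 0 < 1 - τ := by linarith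
    positivity
  -- This is the determinant condition of `herm_nonneg` with one factor `-ρ` cancelled.
  have hdet : ∀ᶠ q in nhds p, ρ q < 0 →
      -ρ q * b q ≤ (levi ρ q + -ρ q * tangentCoeff τ ρ ψ q) * G q := by
    rcases h with h | ⟨h1, h2, D, hD, hlt⟩
    · have hlt : -ρ p * b p < (levi ρ p + -ρ p * tangentCoeff τ ρ ψ p) * G p := by
        simp only [hp, neg_zero, zero_mul, add_zero]
        positivity
      have hc1 : Continuous fun q => -ρ q * b q := by fun_prop
      have hc2 : Continuous fun q => (levi ρ q + -ρ q * tangentCoeff τ ρ ψ q) * G q := by fun_prop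
      filter_upwards [hc1.continuousAt.eventually_lt hc2.continuousAt hlt] with q hq _
      exact hq.le
    -- With no tangential derivative of `ψ` at `p`, the mixed term there is independent of `ψ`.
    · have hbp : b p = mixedNormSq ρ p := by
        have hI : Complex.I • Complex.I • tangent ρ p = -tangent ρ p := by
          rw [smul_smul, Complex.I_mul_I]; simp
        simp only [hb, mixedCoeff, mixedNormSq, h1, h2, hp, hI, map_neg]
        ring
      have hlt' : b p < (tangentCoeff τ ρ ψ p - D) * G p := by
        simp only [hG, herm_collarForm_normal_of_eq_zero τ ψ hp, hbp]
        exact hlt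
      have hc2 : Continuous fun q => (tangentCoeff τ ρ ψ q - D) * G q := by fun_prop
      filter_upwards [hbc.continuousAt.eventually_lt hc2.continuousAt hlt', hD,
        hGc.continuousAt.eventually (lt_mem_nhds hGp)] with q hq hDq hGq hρq
      have e1 : -ρ q * b q ≤ -ρ q * ((tangentCoeff τ ρ ψ q - D) * G q) :=
        mul_le_mul_of_nonneg_left hq.le (by linarith)
      have e2 : 0 ≤ (levi ρ q - D * ρ q) * G q :=
        mul_nonneg (by linarith [hDq hρq]) hGq.le
      nlinarith
  have hdn : 0 < fderiv ℝ ρ p (normal ρ p) := fderiv_normal_pos hd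
  filter_upwards [hdet, hGc.continuousAt.eventually (lt_mem_nhds hGp),
    (continuous_fderiv_apply hρ hN).continuousAt.eventually (lt_mem_nhds hdn)]
    with q hq hGq hnq hρq v
  obtain ⟨c, d, rfl⟩ := exists_eq_tangent_add_normal hnq v
  refine herm_nonneg (collarForm_symm τ hρ hψ q) hGq ?_ c d
  have hI : fderiv ℝ ρ q (Complex.I • Complex.I • tangent ρ q) = 0 := by
    rw [smul_smul, Complex.I_mul_I]; simp [fderiv_tangent]
  rw [herm_collarForm_tangent, herm_collarForm_mixed τ ρ ψ q _ (fderiv_tangent ρ q)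
    (fderiv_I_smul_tangent ρ q), herm_collarForm_mixed τ ρ ψ q _ (fderiv_I_smul_tangent ρ q) hI]
  have := mul_le_mul_of_nonneg_left (hq hρq) (by linarith : 0 ≤ -ρ q)
  simp only [hb, hG] at this
  nlinarith

/-- A function which is nonnegative on the boundary is bounded below by a multiple of the defining
function. -/
theorem eventually_mul_le_of_nonneg {ρ h : ℂ × ℂ → ℝ} (hρ : ContDiff ℝ 1 ρ) (hh : ContDiff ℝ 1 h)
    (hpos : ∀ q, ρ q = 0 → 0 ≤ h q) {p N : ℂ × ℂ} (hp : ρ p = 0) {D : ℝ}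
    (hN : 0 < fderiv ℝ ρ p N) (hD : fderiv ℝ h p N < D * fderiv ℝ ρ p N) :
    ∀ᶠ q in nhds p, ρ q < 0 → D * ρ q ≤ h q := by
  -- From an interior point near `p`, moving along `N` reaches the boundary, where `g = -h ≤ 0`.
  -- Since `g` increases along `N`, it is negative at the starting point.
  set g : ℂ × ℂ → ℝ := fun q => D * ρ q - h q with hg
  have hgc : ContDiff ℝ 1 g := (contDiff_const.mul hρ).sub hh
  have hdg : 0 < fderiv ℝ g p N := by
    have h1 : HasFDerivAt g (D • fderiv ℝ ρ p - fderiv ℝ h p) p :=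
      (((hρ.differentiable (by simp)) p).hasFDerivAt.const_mul D).sub
        ((hh.differentiable (by simp)) p).hasFDerivAt
    rw [h1.fderiv]
    simpa using hD
  have hc1 : Continuous fun q => fderiv ℝ g q N :=
    (hgc.continuous_fderiv (by simp)).clm_apply continuous_const
  have hc2 : Continuous fun q => fderiv ℝ ρ q N :=
    (hρ.continuous_fderiv (by simp)).clm_apply continuous_const
  obtain ⟨δ, hδ, hball⟩ := Metric.eventually_nhds_iff_ball.1
    ((hc1.continuousAt.eventually (lt_mem_nhds hdg)).and
      (hc2.continuousAt.eventually (lt_mem_nhds hN)))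
  obtain ⟨s, hs, hsδ⟩ : ∃ s : ℝ, 0 < s ∧ p + s • N ∈ Metric.ball p δ := by
    have hc : ContinuousAt (fun s : ℝ => p + s • N) 0 := by fun_prop
    have := hc.eventually (Metric.isOpen_ball.mem_nhds (by simpa using hδ :
      p + (0 : ℝ) • N ∈ Metric.ball p δ))
    obtain ⟨s, hs⟩ := ((this.filter_mono nhdsWithin_le_nhds).and
      (self_mem_nhdsWithin : Set.Ioi (0 : ℝ) ∈ nhdsWithin 0 (Set.Ioi 0))).exists
    exact ⟨s, hs.2, hs.1⟩
  have hps : 0 < ρ (p + s • N) := by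
    have := lt_add_smul_of_fderiv_pos hρ (convex_ball p δ) (fun y hy => (hball y hy).2) hs
      (Metric.mem_ball_self hδ) hsδ
    rwa [hp] at this
  have hcs : Continuous fun q : ℂ × ℂ => q + s • N := by fun_prop
  have e1 : ∀ᶠ q in nhds p, q + s • N ∈ Metric.ball p δ :=
    hcs.continuousAt.eventually (Metric.isOpen_ball.mem_nhds hsδ)
  have e2 : ∀ᶠ q in nhds p, 0 < ρ (q + s • N) :=
    (hρ.continuous.comp hcs).continuousAt.eventually (lt_mem_nhds hps)
  filter_upwards [e1, e2, Metric.ball_mem_nhds p hδ] with q hq1 hq2 hq hρq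
  have hcont : ContinuousOn (fun t : ℝ => ρ (q + t • N)) (Set.Icc 0 s) :=
    (hρ.continuous.comp (by fun_prop)).continuousOn
  obtain ⟨t, ht, ht0⟩ := intermediate_value_Icc hs.le hcont
    (show (0 : ℝ) ∈ _ from ⟨by simpa using hρq.le, hq2.le⟩)
  have htpos : 0 < t := by
    rcases ht.1.eq_or_lt with h0 | h0
    · subst h0
      simp only [zero_smul, add_zero] at ht0
      exact absurd ht0 hρq.ne
    · exact h0
  have hmem : q + t • N ∈ Metric.ball p δ := by
    have := (convex_ball p δ).add_smul_sub_mem hq hq1 (t := t / s) ⟨by positivity, by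
      rw [div_le_one hs]; exact ht.2⟩
    simpa [smul_smul, hs.ne'] using this
  have := lt_add_smul_of_fderiv_pos hgc (convex_ball p δ) (fun y hy => (hball y hy).1) htpos hq hmem
  simp only [hg] at this
  have h2 := hpos _ ht0
  simp only at ht0
  rw [ht0] at this
  linarith

/-! ### Construction of the weight. -/

theorem herm_fderiv_fderiv_add {f g : ℂ × ℂ → ℝ} (hf : ContDiff ℝ ∞ f) (hg : ContDiff ℝ ∞ g)
    (p v : ℂ × ℂ) : herm (fderiv ℝ (fderiv ℝ (fun x => f x + g x)) p) v v =
      herm (fderiv ℝ (fderiv ℝ f) p) v v + herm (fderiv ℝ (fderiv ℝ g) p) v v := by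
  rw [fderiv_fderiv_add (hf.contDiffAt.of_le ENat.LEInfty.out)
    (hg.contDiffAt.of_le ENat.LEInfty.out)]
  simp only [herm, add_apply]
  ring

/-- A smooth function with a degenerate minimum along a curve, strictly plurisubharmonic in the
transversal complex directions `T`. -/
theorem IsSimpleSmoothCurve.exists_psh_in_direction {γ : ℝ → ℂ × ℂ} {r : ℝ}
    (hγ : IsSimpleSmoothCurve γ r) {T : ℂ × ℂ → ℂ × ℂ} (hT : Continuous T)
    (hlin : ∀ t ∈ Set.Icc 0 r, LinearIndependent ℝ ![deriv γ t, T (γ t)]) :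
    ∃ f : ℂ × ℂ → ℝ, ContDiff ℝ ∞ f ∧ ∀ p ∈ γ '' Set.Icc 0 r,
      fderiv ℝ f p = 0 ∧ 0 < herm (fderiv ℝ (fderiv ℝ f) p) (T p) (T p) := by
  have hK : IsCompact (γ '' Set.Icc 0 r) := isCompact_Icc.image hγ.smooth.continuous
  have key : ∃ f : ℂ × ℂ → ℝ, ContDiff ℝ ∞ f ∧
      (∀ p ∈ γ '' Set.Icc 0 r, fderiv ℝ f p = 0 ∧
        0 ≤ herm (fderiv ℝ (fderiv ℝ f) p) (T p) (T p)) ∧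
      ∀ p ∈ γ '' Set.Icc 0 r, p ∈ γ '' Set.Icc 0 r →
        0 < herm (fderiv ℝ (fderiv ℝ f) p) (T p) (T p) := by
    -- The property of `s` also demands semipositivity along the whole curve, so that adding two
    -- functions does not destroy positivity on either piece.
    refine hK.induction_on (p := fun s => ∃ f : ℂ × ℂ → ℝ, ContDiff ℝ ∞ f ∧
      (∀ p ∈ γ '' Set.Icc 0 r, fderiv ℝ f p = 0 ∧
        0 ≤ herm (fderiv ℝ (fderiv ℝ f) p) (T p) (T p)) ∧
      ∀ p ∈ s, p ∈ γ '' Set.Icc 0 r →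
        0 < herm (fderiv ℝ (fderiv ℝ f) p) (T p) (T p)) ?_ ?_ ?_ ?_
    · refine ⟨fun _ => 0, contDiff_const, fun p _ => ?_, by simp⟩
      have : fderiv ℝ (fun _ : ℂ × ℂ => (0 : ℝ)) = fun _ => 0 := by ext1; simp
      simp [this, herm]
    · rintro s t hst ⟨f, hf, h1, h2⟩
      exact ⟨f, hf, h1, fun p hp => h2 p (hst hp)⟩
    · rintro s t ⟨f, hf, hf1, hf2⟩ ⟨g, hg, hg1, hg2⟩
      refine ⟨fun x => f x + g x, hf.add hg, fun p hp => ⟨?_, ?_⟩, ?_⟩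
      · rw [fderiv_fun_add (hf.differentiable (by simp) p) (hg.differentiable (by simp) p),
          (hf1 p hp).1, (hg1 p hp).1, add_zero]
      · rw [herm_fderiv_fderiv_add hf hg]
        exact add_nonneg (hf1 p hp).2 (hg1 p hp).2
      · intro p hp hpγ
        rw [herm_fderiv_fderiv_add hf hg]
        rcases hp with hp | hp
        · exact add_pos_of_pos_of_nonneg (hf2 p hp hpγ) (hg1 p hpγ).2
        · exact add_pos_of_nonneg_of_pos (hf1 p hpγ).2 (hg2 p hp hpγ)
    · rintro _ ⟨t, ht, rfl⟩
      obtain ⟨f, hf, hf0, hf1⟩ := hγ.exists_vanishing ht (hlin t ht)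
      have hsq : ContDiff ℝ ∞ fun x : ℝ => x ^ 2 := contDiff_id.pow 2
      have hd1 : deriv (fun x : ℝ => x ^ 2) = fun x => 2 * x := by ext x; simp
      have hd2 : deriv (fun x : ℝ => 2 * x) 0 = 2 := by
        simp
      -- Because `f = 0` on the curve, the second derivative of `f ^ 2` there is `2 df ⊗ df`; the
      -- second derivative of `f` drops out.
      have hherm : ∀ p ∈ γ '' Set.Icc 0 r,
          herm (fderiv ℝ (fderiv ℝ (fun x => f x ^ 2)) p) (T p) (T p) =
            2 * fderiv ℝ f p (T p) ^ 2 + 2 * fderiv ℝ f p (Complex.I • T p) ^ 2 := by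
        intro p hp
        have h2 : ∀ u, fderiv ℝ (fderiv ℝ (fun x => f x ^ 2)) p u u = _ := fun u =>
          fderiv_fderiv_comp (G := fun x => x ^ 2) (hsq.contDiffAt.of_le ENat.LEInfty.out)
            (hf.contDiffAt.of_le ENat.LEInfty.out) u
        rw [herm, h2, h2, hd1, hf0 p hp, hd2]
        ring
      have hcont := continuous_fderiv_apply hf hT
      refine ⟨{p | fderiv ℝ f p (T p) ≠ 0}, nhdsWithin_le_nhds ?_, fun x => f x ^ 2, hf.pow 2,
        fun p hp => ⟨?_, ?_⟩, fun p hp hpγ => ?_⟩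
      · exact hcont.continuousAt.eventually_ne (by rw [hf1]; exact one_ne_zero)
      · have h1 : HasFDerivAt (fun x => f x ^ 2) _ p :=
          (hf.differentiable (by simp) p).hasFDerivAt.pow 2
        rw [h1.fderiv]
        simp [hf0 p hp]
      · rw [hherm p hp]
        positivity
      · rw [hherm p hpγ]
        have : 0 < fderiv ℝ f p (T p) ^ 2 := by
          have : fderiv ℝ f p (T p) ≠ 0 := hp
          positivity
        positivity
  obtain ⟨f, hf, h1, h2⟩ := key
  exact ⟨f, hf, fun p hp => ⟨(h1 p hp).1, h2 p hp hp⟩⟩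

/-- `Re L` is a positive multiple of `tangent ρ p`. This one real direction suffices, since `I • T`
contributes a nonnegative square to the Hessian of `f ^ 2`. -/
theorem linearIndependent_tangent {ρ : ℂ × ℂ → ℝ} {p u : ℂ × ℂ} (hd : fderiv ℝ ρ p ≠ 0)
    (h : LinearIndependent ℝ ![u, realPart (tangentL ρ p), imagPart (tangentL ρ p)]) :
    LinearIndependent ℝ ![u, tangent ρ p] := by
  obtain ⟨s, hs, hL⟩ := tangentL_eq_smul_tangent hd
  rw [LinearIndependent.pair_iff]
  intro a b hab
  have := Fintype.linearIndependent_iff.1 h ![a, b * (2 / s), 0] (by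
    simp only [Fin.sum_univ_three, Matrix.cons_val_zero, Matrix.cons_val_one, Matrix.cons_val,
      realPart, hL, smul_smul, zero_smul, add_zero]
    rw [← hab]
    congr 2
    field_simp)
  have h0 := this 0
  have h1 := this 1
  simp only [Matrix.cons_val_zero, Matrix.cons_val_one] at h0 h1
  refine ⟨h0, ?_⟩
  rcases mul_eq_zero.1 h1 with h | h
  · exact h
  · exact absurd h (by positivity)

/-- A weight making `collarForm` positive near every boundary point. -/
theorem exists_weight {τ : ℝ} (hτ : τ < 1) {ρ : ℂ × ℂ → ℝ} (hρ : ContDiff ℝ ∞ ρ)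
    (hd : ∀ p, ρ p = 0 → fderiv ℝ ρ p ≠ 0) (hlevi : ∀ p, ρ p = 0 → 0 ≤ levi ρ p)
    {K : Set (ℂ × ℂ)} (hK : IsCompact K) (hflat : ∀ p, p ∈ K ↔ ρ p = 0 ∧ levi ρ p = 0)
    {f : ℂ × ℂ → ℝ} (hf : ContDiff ℝ ∞ f) (hf1 : ∀ p ∈ K, fderiv ℝ f p = 0)
    (hf2 : ∀ p ∈ K, 0 < herm (fderiv ℝ (fderiv ℝ f) p) (tangent ρ p) (tangent ρ p)) :
    ∃ ψ : ℂ × ℂ → ℝ, ContDiff ℝ ∞ ψ ∧ ∀ p, ρ p = 0 →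
      ∀ᶠ q in nhds p, ρ q < 0 → ∀ v, 0 ≤ herm (collarForm τ ρ ψ q) v v := by
  have hT := (contDiff_tangent hρ).continuous
  have hN := (contDiff_normal hρ).continuous
  have hIT : Continuous fun q => Complex.I • tangent ρ q := hT.const_smul Complex.I
  have hIN : Continuous fun q => Complex.I • normal ρ q := hN.const_smul Complex.I
  have hnp : ∀ p ∈ K, 0 < fderiv ℝ ρ p (normal ρ p) := fun p hp =>
    fderiv_normal_pos (hd p ((hflat p).1 hp).1)
  have hnsq : ∀ p ∈ K, 0 < (1 - τ) * normalSq ρ p := fun p hp => by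
    have := hnp p hp
    have : 0 < 1 - τ := by linarith
    unfold normalSq
    positivity
  set κ : ℂ × ℂ → ℝ := fun p => herm (fderiv ℝ (fderiv ℝ f) p) (tangent ρ p) (tangent ρ p)
  -- The quotient of normal derivatives is the borderline slope in `levi ρ ≥ D ρ`; adding `1` makes
  -- the inequality strict.
  set D : ℂ × ℂ → ℝ := fun p =>
    fderiv ℝ (levi ρ) p (normal ρ p) / fderiv ℝ ρ p (normal ρ p) + 1
  have hκc : Continuous κ := continuous_herm hf hT hT
  have hDc : ContinuousOn D K :=
    ((continuous_fderiv_apply (contDiff_levi hρ) hN).continuousOn.div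
      (continuous_fderiv_apply hρ hN).continuousOn fun p hp => (hnp p hp).ne').add
      continuousOn_const
  have hmc : Continuous (mixedNormSq ρ) :=
    ((continuous_herm hρ hT hN).pow 2).add ((continuous_herm hρ hIT hN).pow 2)
  have hnc : Continuous (normalSq ρ) :=
    ((continuous_fderiv_apply hρ hN).pow 2).add ((continuous_fderiv_apply hρ hIN).pow 2)
  -- For `ψ = -C f`, `tangentCoeff` equals `C κ` on `K`, so the required inequality says that `C`
  -- exceeds this function. `C = M + 1` with `M` an upper bound does so strictly.
  have hΦ : ContinuousOn (fun p => (D p + mixedNormSq ρ p / ((1 - τ) * normalSq ρ p)) / κ p) K :=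
    (hDc.add (hmc.continuousOn.div (continuous_const.mul hnc).continuousOn
      fun p hp => (hnsq p hp).ne')).div hκc.continuousOn fun p hp => (hf2 p hp).ne'
  obtain ⟨M, hM⟩ := hK.bddAbove_image hΦ
  have hfd : ∀ q, DifferentiableAt ℝ f q := hf.differentiable (by simp)
  have hfdd : Differentiable ℝ (fderiv ℝ f) :=
    (hf.fderiv_right (m := ∞) (by simp)).differentiable (by simp)
  have hψ1 : fderiv ℝ (fun q => (-(M + 1)) * f q) = fun q => (-(M + 1)) • fderiv ℝ f q := by
    ext1 q
    exact ((hfd q).hasFDerivAt.const_mul _).fderiv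
  refine ⟨fun q => (-(M + 1)) * f q, contDiff_const.mul hf, fun p hp => ?_⟩
  refine eventually_collarForm_nonneg hτ hρ (contDiff_const.mul hf) hp (hd p hp) ?_
  rcases (hlevi p hp).lt_or_eq with h | h
  · exact Or.inl h
  · right
    have hpK : p ∈ K := (hflat p).2 ⟨hp, h.symm⟩
    have hψ0 : fderiv ℝ (fun q => (-(M + 1)) * f q) p = 0 := by
      rw [hψ1]; simp only [hf1 p hpK, smul_zero]
    refine ⟨by rw [hψ0]; rfl, by rw [hψ0]; rfl, D p, ?_, ?_⟩
    · refine eventually_mul_le_of_nonneg (hρ.of_le ENat.LEInfty.out)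
        ((contDiff_levi hρ).of_le ENat.LEInfty.out) hlevi hp (hnp p hpK) ?_
      have := hnp p hpK
      simp only [D]
      rw [add_mul, div_mul_cancel₀ _ this.ne']
      linarith
    · have hcoef : tangentCoeff τ ρ (fun q => (-(M + 1)) * f q) p = (M + 1) * κ p := by
        rw [tangentCoeff, hψ0, hψ1]
        have h2 : fderiv ℝ (fun q => (-(M + 1)) • fderiv ℝ f q) p =
            (-(M + 1)) • fderiv ℝ (fderiv ℝ f) p :=
          ((hfdd p).hasFDerivAt.fun_const_smul (-(M + 1))).fderiv
        rw [h2]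
        simp only [herm, smul_apply, smul_eq_mul, zero_apply, κ]
        ring
      rw [hcoef]
      have h1 := hM (Set.mem_image_of_mem _ hpK)
      have hκ : 0 < κ p := hf2 p hpK
      rw [div_le_iff₀ hκ] at h1
      rw [← div_lt_iff₀ (hnsq p hpK)]
      linarith

/-! ### From positivity near the boundary to an exponent. -/

theorem complexHessian_comp {f : ℂ × ℂ → ℝ} {G : ℝ → ℝ} {p : ℂ × ℂ}
    (hG : ContDiffAt ℝ 2 G (f p)) (hf : ContDiffAt ℝ 2 f p) (v : ℂ × ℂ) :
    complexHessian (fun x => G (f x)) p v =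
      deriv (deriv G) (f p) * (1 / 4 * (fderiv ℝ f p v ^ 2 + fderiv ℝ f p (Complex.I • v) ^ 2)) +
        deriv G (f p) * complexHessian f p v := by
  simp only [complexHessian, fderiv_fderiv_comp hG hf]
  ring

theorem deriv_neg_rpow (τ : ℝ) {x : ℝ} (hx : x < 0) :
    deriv (fun x : ℝ => -(-x) ^ τ) x = τ * (-x) ^ (τ - 1) := by
  have := (((hasDerivAt_id x).neg).rpow_const (p := τ) (Or.inl (by simpa using hx.ne))).neg
  have h2 : HasDerivAt (fun x : ℝ => -(-x) ^ τ) _ x := this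
  rw [h2.deriv]
  simp

theorem deriv_deriv_neg_rpow (τ : ℝ) {x : ℝ} (hx : x < 0) :
    deriv (deriv (fun x : ℝ => -(-x) ^ τ)) x = τ * (1 - τ) * (-x) ^ (τ - 2) := by
  have hev : deriv (fun x : ℝ => -(-x) ^ τ) =ᶠ[nhds x] fun x => τ * (-x) ^ (τ - 1) := by
    filter_upwards [gt_mem_nhds hx] with y hy using deriv_neg_rpow τ hy
  rw [hev.deriv_eq]
  have h2 : HasDerivAt (fun x : ℝ => τ * (-x) ^ (τ - 1)) _ x :=
    (((hasDerivAt_id x).neg).rpow_const (p := τ - 1) (Or.inl (by simpa using hx.ne))).const_mul τ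
  rw [h2.deriv]
  simp
  ring_nf

/-- The Hessian of `-(-ρ e ^ ψ) ^ τ`. -/
theorem complexHessian_neg_rpow_mul_exp (τ : ℝ) {ρ ψ : ℂ × ℂ → ℝ} (hρ : ContDiff ℝ ∞ ρ)
    (hψ : ContDiff ℝ ∞ ψ) {p : ℂ × ℂ} (hp : ρ p < 0) (v : ℂ × ℂ) :
    complexHessian (fun q => -(-(ρ q * Real.exp (ψ q))) ^ τ) p v =
      τ * (-(ρ p * Real.exp (ψ p))) ^ (τ - 2) * Real.exp (ψ p) ^ 2 *
        (1 / 4 * herm (collarForm τ ρ ψ p) v v) := by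
  have hneg : ρ p * Real.exp (ψ p) < 0 := mul_neg_of_neg_of_pos hp (Real.exp_pos _)
  have hρ2 : ContDiffAt ℝ 2 ρ p := hρ.contDiffAt.of_le ENat.LEInfty.out
  have hψ2 : ContDiffAt ℝ 2 ψ p := hψ.contDiffAt.of_le ENat.LEInfty.out
  have he2 : ContDiffAt ℝ 2 (fun q => Real.exp (ψ q)) p := Real.contDiff_exp.contDiffAt.comp p hψ2
  have hG : ContDiffAt ℝ 2 (fun x : ℝ => -(-x) ^ τ) (ρ p * Real.exp (ψ p)) :=
    (contDiffAt_id.neg.rpow_const_of_ne (by simpa using hneg.ne)).neg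
  have hde : fderiv ℝ (fun q => Real.exp (ψ q)) p = Real.exp (ψ p) • fderiv ℝ ψ p :=
    (hψ2.differentiableAt (by simp)).hasFDerivAt.exp.fderiv
  have hdR : fderiv ℝ (fun q => ρ q * Real.exp (ψ q)) p = _ :=
    fderiv_fun_mul (hρ2.differentiableAt (by simp)) (he2.differentiableAt (by simp))
  have hdde : ∀ u, fderiv ℝ (fderiv ℝ (fun q => Real.exp (ψ q))) p u u = _ := fun u =>
    fderiv_fderiv_comp (G := Real.exp) Real.contDiff_exp.contDiffAt hψ2 u
  rw [complexHessian_comp (f := fun q => ρ q * Real.exp (ψ q)) (G := fun x => -(-x) ^ τ) hG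
    (hρ2.mul he2), deriv_neg_rpow τ hneg, deriv_deriv_neg_rpow τ hneg]
  -- Both derivatives of `-(-x) ^ τ` are brought to the common power `τ - 2`, which becomes the
  -- positive prefactor.
  have hpow : (-(ρ p * Real.exp (ψ p))) ^ (τ - 1) =
      (-(ρ p * Real.exp (ψ p))) ^ (τ - 2) * (-(ρ p * Real.exp (ψ p))) := by
    rw [← Real.rpow_add_one (by linarith)]
    ring_nf
  rw [hpow, complexHessian, fderiv_fderiv_mul hρ2 he2, fderiv_fderiv_mul hρ2 he2, hdR, hdde, hdde,
    hde]
  simp only [Real.deriv_exp, herm, collarForm_apply, add_apply, smul_apply, smul_eq_mul]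
  ring

theorem complexHessian_congr {f g : ℂ × ℂ → ℝ} {p : ℂ × ℂ} (h : f =ᶠ[nhds p] g) (v : ℂ × ℂ) :
    complexHessian f p v = complexHessian g p v := by
  rw [complexHessian, complexHessian, (h.fderiv (𝕜 := ℝ)).fderiv_eq]

theorem IsDefiningFunction.eq_zero_iff {Ω : Set (ℂ × ℂ)} {ρ : ℂ × ℂ → ℝ}
    (hρ : IsDefiningFunction Ω ρ) (hΩ : IsOpen Ω) (p : ℂ × ℂ) : ρ p = 0 ↔ p ∈ frontier Ω := by
  have h := hρ.pos_iff p
  rw [hΩ.frontier_eq, Set.mem_sdiff, ← hρ.neg_iff]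
  constructor
  · intro h0
    exact ⟨not_not.1 fun hc => (h.2 hc).ne' h0, h0.not_lt⟩
  · rintro ⟨h1, h2⟩
    exact le_antisymm (not_lt.1 fun h0 => h.1 h0 h1) (not_lt.1 h2)

/-- `g ∘ (ρ e ^ ψ)` is a defining function if `g` preserves signs and is the identity near `0`. -/
theorem IsDefiningFunction.comp_mul_exp {Ω : Set (ℂ × ℂ)} {ρ ψ : ℂ × ℂ → ℝ} {g : ℝ → ℝ}
    (hρ : IsDefiningFunction Ω ρ) (hΩ : IsOpen Ω) (hψ : ContDiff ℝ ∞ ψ) (hg : ContDiff ℝ ∞ g)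
    (hgneg : ∀ x < 0, g x < 0) (hgnonneg : ∀ x, 0 ≤ x → g x = x)
    (hg0 : ∀ᶠ x in nhds 0, g x = x) :
    IsDefiningFunction Ω fun p => g (ρ p * Real.exp (ψ p)) := by
  have hR : ContDiff ℝ ∞ fun p => ρ p * Real.exp (ψ p) := hρ.smooth.mul hψ.exp
  refine ⟨hg.comp hR, fun p => ?_, fun p => ?_, fun p hp => ?_⟩
  · rw [← hρ.neg_iff]
    constructor
    · intro h
      by_contra h0
      have : 0 ≤ ρ p * Real.exp (ψ p) := mul_nonneg (not_lt.1 h0) (Real.exp_pos _).le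
      rw [hgnonneg _ this] at h
      linarith
    · exact fun h => hgneg _ (mul_neg_of_neg_of_pos h (Real.exp_pos _))
  · rw [← hρ.pos_iff]
    constructor
    · intro h
      by_contra h0
      rcases (not_lt.1 h0).lt_or_eq with h1 | h1
      · exact absurd (hgneg _ (mul_neg_of_neg_of_pos h1 (Real.exp_pos (ψ p)))) h.le.not_gt
      · rw [h1, zero_mul, hgnonneg 0 le_rfl] at h
        exact lt_irrefl _ h
    · intro h
      have : 0 < ρ p * Real.exp (ψ p) := mul_pos h (Real.exp_pos _)
      rwa [hgnonneg _ this.le]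
  · have hp0 : ρ p = 0 := (hρ.eq_zero_iff hΩ p).2 hp
    have hev : (fun q => g (ρ q * Real.exp (ψ q))) =ᶠ[nhds p] fun q => ρ q * Real.exp (ψ q) := by
      have h0 : ∀ᶠ x in nhds (ρ p * Real.exp (ψ p)), g x = x := by simpa [hp0] using hg0
      exact hR.continuous.continuousAt.eventually h0
    rw [hev.fderiv_eq, fderiv_fun_mul (hρ.smooth.differentiable (by simp) p)
      (hψ.exp.differentiable (by simp) p), hp0, zero_smul, zero_add]
    exact smul_ne_zero (Real.exp_pos _).ne' (hρ.fderiv_ne_zero p hp)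

/-- Positivity of `collarForm` near the boundary yields a Diederich–Fornæss exponent. -/
theorem isDFExponent_of_collarForm_nonneg {Ω : Set (ℂ × ℂ)} {ρ ψ : ℂ × ℂ → ℝ} {τ : ℝ}
    (hΩ : IsOpen Ω) (hbdd : Bornology.IsBounded Ω) (hρ : IsDefiningFunction Ω ρ) (hτ0 : 0 < τ)
    (hτ1 : τ < 1) (hψ : ContDiff ℝ ∞ ψ)
    (hpos : ∀ p, ρ p = 0 →
      ∀ᶠ q in nhds p, ρ q < 0 → ∀ v, 0 ≤ herm (collarForm τ ρ ψ q) v v) :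
    IsDFExponent Ω τ := by
  set U : Set (ℂ × ℂ) := {q | ρ q < 0 → ∀ v, 0 ≤ herm (collarForm τ ρ ψ q) v v} with hU
  set R : ℂ × ℂ → ℝ := fun q => ρ q * Real.exp (ψ q) with hR
  have hRs : ContDiff ℝ ∞ R := hρ.smooth.mul hψ.exp
  have hRneg : ∀ q, ρ q < 0 → R q < 0 := fun q hq => mul_neg_of_neg_of_pos hq (Real.exp_pos _)
  have hC : IsCompact (closure Ω \ interior U) := hbdd.isCompact_closure.diff isOpen_interior
  -- `U` is a neighbourhood of the boundary, so the rest of the closure is compact and lies in `ρ <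
  -- 0`, where `R` has a negative maximum.
  obtain ⟨δ, hδ, hδC⟩ : ∃ δ > 0, ∀ q ∈ closure Ω \ interior U, R q ≤ -δ := by
    rcases (closure Ω \ interior U).eq_empty_or_nonempty with h | h
    · exact ⟨1, one_pos, by simp [h]⟩
    · obtain ⟨q₀, hq₀, hmax⟩ := hC.exists_isMaxOn h hRs.continuous.continuousOn
      refine ⟨-R q₀, neg_pos.2 (hRneg q₀ ?_), fun q hq => by rw [neg_neg]; exact hmax hq⟩
      have h1 : ¬ 0 < ρ q₀ := fun h => (hρ.pos_iff q₀).1 h hq₀.1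
      refine lt_of_le_of_ne (not_lt.1 h1) fun h0 => hq₀.2 ?_
      exact mem_interior_iff_mem_nhds.2 (hpos q₀ h0)
  have hδτ : 0 < δ ^ τ := Real.rpow_pos_of_pos hδ _
  -- With `ε = δ ^ τ / 2`, the derivative of `X` vanishes as soon as `-(-R) ^ τ ≤ -δ ^ τ`, that is,
  -- `R ≤ -δ`, which covers all points outside `interior U`.
  obtain ⟨g, X, hg, hgneg, hg0, hgnonneg, hX, hgX, hX1, hX2, hX0⟩ :=
    exists_truncation_rpow hτ0 (half_pos hδτ)
  have hdef := hρ.comp_mul_exp hΩ hψ hg hgneg hgnonneg hg0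
  refine ⟨hτ0, hτ1, _, hdef, ?_, ?_⟩
  · intro q hq
    have hne : -g (R q) ≠ 0 := neg_ne_zero.2 ((hdef.neg_iff q).2 hq).ne
    exact (((hdef.smooth.contDiffAt.of_le ENat.LEInfty.out).neg.rpow_const_of_ne
      hne).neg).contDiffWithinAt
  · intro q hq v
    have hρq : ρ q < 0 := (hρ.neg_iff q).2 hq
    have hRq := hRneg q hρq
    have hev : (fun p => -(-g (R p)) ^ τ) =ᶠ[nhds q] fun p => X (-(-R p) ^ τ) := by
      filter_upwards [hΩ.mem_nhds hq] with p hp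
      exact hgX _ (hRneg p ((hρ.neg_iff p).2 hp))
    rw [complexHessian_congr hev, complexHessian_comp (f := fun p => -(-R p) ^ τ)
      (hX.contDiffAt.of_le ENat.LEInfty.out)
      (((hRs.contDiffAt.of_le ENat.LEInfty.out).neg.rpow_const_of_ne
        (neg_ne_zero.2 hRq.ne)).neg)]
    refine add_nonneg (mul_nonneg (hX2 _) (by positivity)) ?_
    rcases le_or_gt (-(-R q) ^ τ) (-2 * (δ ^ τ / 2)) with h | h
    · rw [hX0 _ h, zero_mul]
    · refine mul_nonneg (hX1 _) ?_
      have hlt : -R q < δ := by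
        rw [← Real.rpow_lt_rpow_iff (by linarith) hδ.le hτ0]
        linarith
      have hqU : q ∈ U := by
        by_contra hqU
        have := hδC q ⟨subset_closure hq, fun h => hqU (interior_subset h)⟩
        linarith
      rw [complexHessian_neg_rpow_mul_exp τ hρ.smooth hψ hρq]
      have h1 := hqU hρq v
      have h2 : 0 < (-(ρ q * Real.exp (ψ q))) ^ (τ - 2) :=
        Real.rpow_pos_of_pos (neg_pos.2 hRq) _
      positivity

end DFIndex

end

/-! ### The index. -/

theorem theorem1p3 (Ω : Set (ℂ × ℂ))
    (hopen : IsOpen Ω) (hconn : IsConnected Ω) (hbdd : Bornology.IsBounded Ω)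
    (ρ : ℂ × ℂ → ℝ) (hρ : DFIndex.IsDefiningFunction Ω ρ)
    (hpsc : DFIndex.IsPseudoconvex Ω ρ)
    (γ : ℝ → ℂ × ℂ) (r : ℝ) (hγ : DFIndex.IsSimpleSmoothCurve γ r)
    (hflat : DFIndex.leviFlatSet Ω ρ = γ '' Set.Icc 0 r)
    (htrans : ∀ t ∈ Set.Icc 0 r, DFIndex.TransversalAt γ t (DFIndex.tangentL ρ (γ t))) :
    DFIndex.dfIndex Ω = 1 := by
  have hzero := hρ.eq_zero_iff hopen
  have hd : ∀ p, ρ p = 0 → fderiv ℝ ρ p ≠ 0 := fun p hp =>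
    hρ.fderiv_ne_zero p ((hzero p).1 hp)
  have hlevi : ∀ p, ρ p = 0 → 0 ≤ DFIndex.levi ρ p := fun p hp => by
    obtain ⟨s, hs, h⟩ := DFIndex.complexHessian_tangentL (hd p hp)
    have := hpsc p ((hzero p).1 hp)
    rw [h] at this
    exact nonneg_of_mul_nonneg_right this hs
  have hK : ∀ p, p ∈ γ '' Set.Icc 0 r ↔ ρ p = 0 ∧ DFIndex.levi ρ p = 0 := fun p => by
    rw [← hflat, DFIndex.leviFlatSet, Set.mem_ofPred_eq, ← hzero]
    refine and_congr_right fun hp => ?_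
    obtain ⟨s, hs, h⟩ := DFIndex.complexHessian_tangentL (hd p hp)
    rw [h, mul_eq_zero, or_iff_right hs.ne']
  obtain ⟨f, hf, hf1⟩ := hγ.exists_psh_in_direction
    (DFIndex.contDiff_tangent hρ.smooth).continuous fun t ht =>
      DFIndex.linearIndependent_tangent (hd _ ((hK _).1 (Set.mem_image_of_mem γ ht)).1)
        (htrans t ht)
  -- The weight depends on `τ`, its multiple growing as `τ → 1`, but `f` is the same for all
  -- exponents.
  have hset : {τ : ℝ | DFIndex.IsDFExponent Ω τ} = Set.Ioo 0 1 := by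
    ext τ
    refine ⟨fun h => ⟨h.1, h.2.1⟩, fun h => ?_⟩
    obtain ⟨ψ, hψ, hpos⟩ := DFIndex.exists_weight h.2 hρ.smooth hd hlevi
      (isCompact_Icc.image hγ.smooth.continuous) hK hf (fun p hp => (hf1 p hp).1)
      fun p hp => (hf1 p hp).2
    exact DFIndex.isDFExponent_of_collarForm_nonneg hopen hbdd hρ h.1 h.2 hψ hpos
  rw [DFIndex.dfIndex, hset, csSup_Ioo zero_lt_one]
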